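/- Let $\Omega\subset\mathbb R^4$ be open with coordinates $(u,v,U,V)$, let $A,B,C:\Omega\to\mathbb R$ be functions of class $C^2$, and let $$g = 2\,du\,(dv + A\,du + C\,dU) + 2\,dU\,(dV + B\,dU)$$ be the corresponding four-dimensional neutral-signature Walker metric, whose parallel null 2-planes are spanned by $\partial_v,\partial_V$. Let $(\ell,n,m,\tilde m)$ be a real null tetrad on $\Omega$ (that is, $\ell\cdot n=1$, $m\cdot\tilde m=-1$, all other scalar products vanish) with $\ell$ and $\tilde m$ in the span of $\partial_v,\partial_V$; for instance the natural one $\ell=\partial_v$, $n=\partial_u-A\partial_v-\tfrac12C\partial_V$, $\tilde m=\partial_V$, $m=-\partial_U+B\partial_V+\tfrac12C\partial_v$. With $C_{abcd}$ the Weyl tensor, put $$\Psi_0=C_{abcd}\ell^am^b\ell^cm^d,\quad \Psi_1=C_{abcd}\ell^am^b\ell^cn^d,\quad \Psi_2=C_{abcd}\ell^am^b\tilde m^cn^d,\quad \Psi_3=C_{abcd}\ell^an^b\tilde m^cn^d,\quad \Psi_4=C_{abcd}n^a\tilde m^bn^c\tilde m^d$$ (the self-dual components), and let $\tilde\Psi_i$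 be obtained from $\Psi_i$ by interchanging $m$ and $\tilde m$ (the anti-self-dual components). Suppose that $g$ is Einstein, i.e. $R_{ab}=\lambda g_{ab}$ with a constant $\lambda$, that $\Psi_0,\dots,\Psi_4$ are constant on $\Omega$, and that either $\tilde\Psi_3=0$ on $\Omega$ or $\Psi_1^2\Psi_4=\Psi_0\Psi_3^2$. Then $g$ is 0-universal: every symmetric rank-2 tensor field on $\Omega$ constructed polynomially from the metric and the Riemann (equivalently, the Weyl) tensor without derivatives, i.e. every symmetric rank-2 real linear combination of contractions and index permutations of tensor products of copies of these tensors, is a constant multiple of $g$. -/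

import Mathlib

namespace WalkerGeom

noncomputable section

/-! ### Curvature of a metric on a coordinate domain of dimension four

Points, and tangent vectors in the coordinate basis, are elements of `Fin 4 → ℝ`; a metric is the
field of matrices `g x a b` of its covariant components. -/

/-- Rank-4 covariant tensors at a point, by components. -/
abbrev Tensor4 : Type := Fin 4 → Fin 4 → Fin 4 → Fin 4 → ℝ

/-- The partial derivative of `f` in the direction of the `i`-th coordinate. -/
def pderiv (i : Fin 4) (f : (Fin 4 → ℝ) → ℝ) (x : Fin 4 → ℝ) : ℝ :=
  fderiv ℝ f x (Pi.single i 1)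

/-- Christoffel symbols `Γ^a_{bc}` of the Levi-Civita connection. -/
def christoffel (g : (Fin 4 → ℝ) → Matrix (Fin 4) (Fin 4) ℝ) (a b c : Fin 4)
    (x : Fin 4 → ℝ) : ℝ :=
  (1 / 2) * ∑ d, (g x)⁻¹ a d *
    (pderiv b (fun y => g y d c) x + pderiv c (fun y => g y b d) x - pderiv d (fun y => g y b c) x)

/-- `R^a_{bcd} = ∂_c Γ^a_{db} - ∂_d Γ^a_{cb} + Γ^a_{ce} Γ^e_{db} - Γ^a_{de} Γ^e_{cb}`. -/
def riemannUp (g : (Fin 4 → ℝ) → Matrix (Fin 4) (Fin 4) ℝ) (x : Fin 4 → ℝ) : Tensor4 :=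
  fun a b c d =>
    pderiv c (christoffel g a d b) x - pderiv d (christoffel g a c b) x
      + ∑ e, (christoffel g a c e x * christoffel g e d b x
          - christoffel g a d e x * christoffel g e c b x)

/-- The Riemann tensor `R_{abcd}`. -/
def riemann (g : (Fin 4 → ℝ) → Matrix (Fin 4) (Fin 4) ℝ) (x : Fin 4 → ℝ) : Tensor4 :=
  fun a b c d => ∑ e, g x a e * riemannUp g x e b c d

/-- The Ricci tensor `R_{bd} = R^a_{bad}`. -/
def ricci (g : (Fin 4 → ℝ) → Matrix (Fin 4) (Fin 4) ℝ) (x : Fin 4 → ℝ) (b d : Fin 4) : ℝ :=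
  ∑ a, riemannUp g x a b a d

/-- The scalar curvature. -/
def scalarCurv (g : (Fin 4 → ℝ) → Matrix (Fin 4) (Fin 4) ℝ) (x : Fin 4 → ℝ) : ℝ :=
  ∑ a, ∑ b, (g x)⁻¹ a b * ricci g x a b

/-- The Weyl tensor `C_{abcd}` in dimension four. -/
def weyl (g : (Fin 4 → ℝ) → Matrix (Fin 4) (Fin 4) ℝ) (x : Fin 4 → ℝ) : Tensor4 :=
  fun a b c d =>
    riemann g x a b c d
      - (1 / 2) * (g x a c * ricci g x b d - g x a d * ricci g x b c
          - g x b c * ricci g x a d + g x b d * ricci g x a c)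
      + (scalarCurv g x / 6) * (g x a c * g x b d - g x a d * g x b c)

/-- `g` is an Einstein metric on `Ω`: `R_{ab} = lam g_{ab}` with a constant `lam`. -/
def IsEinsteinOn (g : (Fin 4 → ℝ) → Matrix (Fin 4) (Fin 4) ℝ) (Ω : Set (Fin 4 → ℝ)) : Prop :=
  ∃ lam : ℝ, ∀ x ∈ Ω, ∀ a b, ricci g x a b = lam * g x a b

/-! ### Walker metrics -/

/-- The Walker metric `2 du (dv + A du + C dU) + 2 dU (dV + B dU)`; the coordinates are
`(u, v, U, V) = (x 0, x 1, x 2, x 3)`. -/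
def walkerMetric (A B C : (Fin 4 → ℝ) → ℝ) (x : Fin 4 → ℝ) : Matrix (Fin 4) (Fin 4) ℝ :=
  !![2 * A x, 1, C x, 0;
     1, 0, 0, 0;
     C x, 0, 2 * B x, 1;
     0, 0, 1, 0]

/-! ### Real null tetrads and Weyl components -/

/-- Four tangent vectors `ℓ, n, m, m̃` at a point. -/
structure Tetrad where
  l : Fin 4 → ℝ
  n : Fin 4 → ℝ
  m : Fin 4 → ℝ
  mt : Fin 4 → ℝ

/-- The tilde operation: interchange of `m` and `m̃`. -/
def Tetrad.tilde (e : Tetrad) : Tetrad := ⟨e.l, e.n, e.mt, e.m⟩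

/-- Scalar product of two tangent vectors. -/
def ip (g : Matrix (Fin 4) (Fin 4) ℝ) (X Y : Fin 4 → ℝ) : ℝ := ∑ a, ∑ b, g a b * X a * Y b

/-- `ℓ·n = 1`, `m·m̃ = -1`, and all other scalar products vanish. -/
structure Tetrad.IsNull (g : Matrix (Fin 4) (Fin 4) ℝ) (e : Tetrad) : Prop where
  l_n : ip g e.l e.n = 1
  m_mt : ip g e.m e.mt = -1
  l_l : ip g e.l e.l = 0
  n_n : ip g e.n e.n = 0
  m_m : ip g e.m e.m = 0
  mt_mt : ip g e.mt e.mt = 0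
  l_m : ip g e.l e.m = 0
  l_mt : ip g e.l e.mt = 0
  n_m : ip g e.n e.m = 0
  n_mt : ip g e.n e.mt = 0

/-- `ℓ` and `m̃` lie in (hence span) the null plane of the vectors `∂_v, ∂_V`, the parallel null
plane of a Walker metric. -/
def Tetrad.IsAdapted (e : Tetrad) : Prop :=
  e.l ∈ Submodule.span ℝ {(Pi.single 1 1 : Fin 4 → ℝ), Pi.single 3 1} ∧
    e.mt ∈ Submodule.span ℝ {(Pi.single 1 1 : Fin 4 → ℝ), Pi.single 3 1}

/-- Evaluation of a rank-4 tensor on four vectors. -/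
def Tensor4.contr (W : Tensor4) (X Y Z T : Fin 4 → ℝ) : ℝ :=
  ∑ a, ∑ b, ∑ c, ∑ d, W a b c d * X a * Y b * Z c * T d

/-- The components `Ψ₀, …, Ψ₄` of a Weyl tensor in a null tetrad. -/
def Tetrad.psi (e : Tetrad) (W : Tensor4) : Fin 5 → ℝ :=
  ![W.contr e.l e.m e.l e.m,
    W.contr e.l e.m e.l e.n,
    W.contr e.l e.m e.mt e.n,
    W.contr e.l e.n e.mt e.n,
    W.contr e.n e.mt e.n e.mt]

/-- The components `Ψ̃₀, …, Ψ̃₄`. -/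
def Tetrad.psiTilde (e : Tetrad) (W : Tensor4) : Fin 5 → ℝ := e.tilde.psi W

/-- The natural tetrad `ℓ = ∂_v`, `n = ∂_u - A ∂_v - (C/2) ∂_V`, `m = -∂_U + B ∂_V + (C/2) ∂_v`,
`m̃ = ∂_V` of a Walker metric. -/
def walkerTetrad (A B C : (Fin 4 → ℝ) → ℝ) (x : Fin 4 → ℝ) : Tetrad where
  l := ![0, 1, 0, 0]
  n := ![1, -A x, 0, -(C x / 2)]
  m := ![0, C x / 2, -1, B x]
  mt := ![0, 0, 0, 1]

theorem walkerTetrad_isNull (A B C : (Fin 4 → ℝ) → ℝ) (x : Fin 4 → ℝ) :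
    (walkerTetrad A B C x).IsNull (walkerMetric A B C x) := by
  constructor <;> simp [ip, walkerTetrad, walkerMetric, Fin.sum_univ_four] <;> ring

theorem walkerTetrad_isAdapted (A B C : (Fin 4 → ℝ) → ℝ) (x : Fin 4 → ℝ) :
    (walkerTetrad A B C x).IsAdapted := by
  constructor <;> apply Submodule.subset_span
  · left
    ext i
    fin_cases i <;> simp [walkerTetrad]
  · right
    ext i
    fin_cases i <;> simp [walkerTetrad]

/-! ### Tensors constructed polynomially from the metric and the curvature, without derivatives -/

/-- Formal expressions of rank `k` (all free indices lowered): real linear combinations of index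
permutations and complete or partial metric contractions of tensor products of copies of the
metric, the Riemann tensor and the Weyl tensor. -/
inductive TensorExpr : ℕ → Type
  | metric : TensorExpr 2
  | riemann : TensorExpr 4
  | weyl : TensorExpr 4
  | smul {k : ℕ} (c : ℝ) (S : TensorExpr k) : TensorExpr k
  | add {k : ℕ} (S T : TensorExpr k) : TensorExpr k
  | tprod {j k : ℕ} (S : TensorExpr j) (T : TensorExpr k) : TensorExpr (j + k)
  | perm {k : ℕ} (σ : Equiv.Perm (Fin k)) (S : TensorExpr k) : TensorExpr k
  | contract {k : ℕ} (S : TensorExpr (k + 2)) : TensorExpr k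

/-- The components of an expression, for the metric `g`, Riemann tensor `R` and Weyl tensor `W`
at a point. Contraction is on the first two slots, with the inverse metric. -/
def TensorExpr.eval (g : Matrix (Fin 4) (Fin 4) ℝ) (R W : Tensor4) :
    {k : ℕ} → TensorExpr k → (Fin k → Fin 4) → ℝ
  | _, .metric, I => g (I 0) (I 1)
  | _, .riemann, I => R (I 0) (I 1) (I 2) (I 3)
  | _, .weyl, I => W (I 0) (I 1) (I 2) (I 3)
  | _, .smul c S, I => c * S.eval g R W I
  | _, .add S T, I => S.eval g R W I + T.eval g R W I
  | _, .tprod (j := j) (k := k) S T, I =>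
      S.eval g R W (fun i => I (Fin.castAdd k i)) * T.eval g R W (fun i => I (Fin.natAdd j i))
  | _, .perm σ S, I => S.eval g R W (fun i => I (σ i))
  | _, .contract S, I =>
      ∑ a, ∑ b, g⁻¹ a b * S.eval g R W (Fin.cons a (Fin.cons b I))

/-- The rank-2 tensor field on the coordinate domain defined by an expression. -/
def TensorExpr.field2 (T : TensorExpr 2) (g : (Fin 4 → ℝ) → Matrix (Fin 4) (Fin 4) ℝ)
    (x : Fin 4 → ℝ) (a b : Fin 4) : ℝ :=
  T.eval (g x) (WalkerGeom.riemann g x) (WalkerGeom.weyl g x) ![a, b]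

/-- `g` is 0-universal on `Ω`: every symmetric rank-2 tensor field constructed from the metric and
the Riemann (or Weyl) tensor without derivatives, in particular every conserved one, is a constant
multiple of the metric. -/
def IsZeroUniversalOn (g : (Fin 4 → ℝ) → Matrix (Fin 4) (Fin 4) ℝ) (Ω : Set (Fin 4 → ℝ)) : Prop :=
  ∀ T : TensorExpr 2,
    (∀ x ∈ Ω, ∀ a b, T.field2 g x a b = T.field2 g x b a) →
      ∃ c : ℝ, ∀ x ∈ Ω, ∀ a b, T.field2 g x a b = c * g x a b

end

end WalkerGeom

/-! The argument is pointwise. A tensor constructed from the metric and the curvature commutes with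
changes of frame (`TensorExpr.eval_pull`). For an Einstein metric its components in a null tetrad
are therefore functions of `lam` and of the ten numbers `Ψ`, `Ψ̃` alone (`TensorExpr.frameEval_eq`).
Since the curvature preserves the parallel null plane, `Ψ̃₀ = Ψ̃₁ = 0` and `Ψ̃₂ = -lam / 3` in an
adapted tetrad (`walkerMetric_framePsi'`). With `Ψ` constant, only `Ψ̃₃` and `Ψ̃₄` can vary with the
point.

These two are controlled by `SL(2, ℝ)` acting on primed spinors, which fixes every `Ψᵢ`. If `Ψ̃₂ ≠
0`, a null rotation makes `Ψ̃₃` vanish. A boost then multiplies `Ψ̃₄` by `t ^ 4`, while each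
component of a rank-2 tensor is multiplied by `t ^ 2`, `1` or `t ^ (-2)`. Letting `t → 0`,
regularity in `Ψ̃₄` makes the components of nonzero weight vanish and those of weight zero equal to
their values at `Ψ̃₄ = 0`. There the exchange of the two primed basis spinors is a further symmetry,
and a symmetric tensor invariant under it has only a multiple of the metric left in weight zero. The
case `Ψ̃₂ = 0` follows by continuity (`TensorExpr.frameEval_eq_smul_eta`). The factor depends only
on `lam` and `Ψ`, hence is the same at all points. -/

namespace WalkerGeom
noncomputable section

/-! ### Change of frame -/

/-- The components of a covariant tensor in the frame given by the columns of `P`. -/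
def pullback (P : Matrix (Fin 4) (Fin 4) ℝ) {k : ℕ} (S : (Fin k → Fin 4) → ℝ)
    (I : Fin k → Fin 4) : ℝ :=
  ∑ J : Fin k → Fin 4, (∏ i, P (J i) (I i)) * S J

/-- The components of a rank-4 tensor in the frame given by the columns of `P`. -/
def Tensor4.pull (P : Matrix (Fin 4) (Fin 4) ℝ) (W : Tensor4) : Tensor4 :=
  fun a b c d => W.contr (P.col a) (P.col b) (P.col c) (P.col d)

theorem sum_fin_succ_pi {k : ℕ} (f : (Fin (k + 1) → Fin 4) → ℝ) :
    ∑ J, f J = ∑ a, ∑ J : Fin k → Fin 4, f (Fin.cons a J) := by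
  rw [← (Fin.consEquiv (fun _ => Fin 4)).sum_comp, Fintype.sum_prod_type]
  rfl

theorem sum_fin_zero_pi (f : (Fin 0 → Fin 4) → ℝ) : ∑ J, f J = f ![] := by
  rw [Fintype.sum_unique]
  congr 1

theorem sum_fin_two_pi (f : (Fin 2 → Fin 4) → ℝ) : ∑ J, f J = ∑ a, ∑ b, f ![a, b] := by
  simp only [sum_fin_succ_pi, sum_fin_zero_pi]
  rfl

theorem sum_fin_four_pi (f : (Fin 4 → Fin 4) → ℝ) :
    ∑ J, f J = ∑ a, ∑ b, ∑ c, ∑ d, f ![a, b, c, d] := by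
  simp only [sum_fin_succ_pi, sum_fin_zero_pi]
  rfl

theorem pullback_rank_two (P g : Matrix (Fin 4) (Fin 4) ℝ) (I : Fin 2 → Fin 4) :
    pullback P (fun J => g (J 0) (J 1)) I = (P.transpose * g * P) (I 0) (I 1) := by
  simp only [pullback, sum_fin_two_pi, Fin.prod_univ_two, Matrix.mul_apply, Finset.sum_mul,
    Matrix.transpose_apply]
  rw [Finset.sum_comm]
  refine Finset.sum_congr rfl fun b _ => Finset.sum_congr rfl fun a _ => ?_
  simp
  ring

theorem pullback_rank_four (P : Matrix (Fin 4) (Fin 4) ℝ) (W : Tensor4) (I : Fin 4 → Fin 4) :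
    pullback P (fun J => W (J 0) (J 1) (J 2) (J 3)) I =
      W.pull P (I 0) (I 1) (I 2) (I 3) := by
  simp only [pullback, sum_fin_four_pi, Fin.prod_univ_four, Tensor4.pull, Tensor4.contr]
  refine Finset.sum_congr rfl fun a _ => Finset.sum_congr rfl fun b _ =>
    Finset.sum_congr rfl fun c _ => Finset.sum_congr rfl fun d _ => ?_
  simp [Matrix.col]
  ring

theorem pullback_tprod (P : Matrix (Fin 4) (Fin 4) ℝ) {j k : ℕ} (S : (Fin j → Fin 4) → ℝ)
    (T : (Fin k → Fin 4) → ℝ) (I : Fin (j + k) → Fin 4) :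
    pullback P (fun J => S (fun i => J (Fin.castAdd k i)) * T (fun i => J (Fin.natAdd j i))) I =
      pullback P S (fun i => I (Fin.castAdd k i)) * pullback P T (fun i => I (Fin.natAdd j i)) := by
  simp only [pullback]
  rw [← (Fin.appendEquiv j k).sum_comp, Fintype.sum_prod_type, Finset.sum_mul_sum]
  refine Finset.sum_congr rfl fun J _ => Finset.sum_congr rfl fun K _ => ?_
  simp only [Fin.appendEquiv, Equiv.coe_fn_mk, Fin.prod_univ_add, Fin.append_left, Fin.append_right]
  ring

theorem pullback_perm (P : Matrix (Fin 4) (Fin 4) ℝ) {k : ℕ} (σ : Equiv.Perm (Fin k))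
    (S : (Fin k → Fin 4) → ℝ) (I : Fin k → Fin 4) :
    pullback P (fun J => S (fun i => J (σ i))) I = pullback P S (fun i => I (σ i)) := by
  simp only [pullback]
  rw [← (Equiv.arrowCongr σ (Equiv.refl (Fin 4))).sum_comp]
  refine Finset.sum_congr rfl fun J _ => ?_
  rw [← Equiv.prod_comp σ]
  simp

theorem pullback_contract {P g : Matrix (Fin 4) (Fin 4) ℝ} (hP : IsUnit P.det) {k : ℕ}
    (S : (Fin (k + 2) → Fin 4) → ℝ) (I : Fin k → Fin 4) :
    pullback P (fun J => ∑ a, ∑ b, g⁻¹ a b * S (Fin.cons a (Fin.cons b J))) I =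
      ∑ a, ∑ b, (P.transpose * g * P)⁻¹ a b * pullback P S (Fin.cons a (Fin.cons b I)) := by
  have hP' : IsUnit P.transpose.det := by rwa [Matrix.det_transpose]
  -- The inverse metric transforms contragrediently. Only `P` has to be invertible, because
  -- `Matrix.mul_inv_rev` also holds for the default inverse of a singular `g`.
  have key : P * (P.transpose * g * P)⁻¹ * P.transpose = g⁻¹ := by
    rw [Matrix.mul_inv_rev, Matrix.mul_inv_rev, ← Matrix.mul_assoc, Matrix.mul_nonsing_inv _ hP,
      Matrix.one_mul, Matrix.mul_assoc, Matrix.nonsing_inv_mul _ hP', Matrix.mul_one]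
  have key' : ∀ c d, g⁻¹ c d = ∑ a, ∑ b, (P.transpose * g * P)⁻¹ a b * P c a * P d b := by
    intro c d
    rw [← key]
    simp only [Matrix.mul_apply (M := P * _), Matrix.mul_apply (M := P), Finset.sum_mul,
      Matrix.transpose_apply P]
    rw [Finset.sum_comm]
    refine Finset.sum_congr rfl fun a _ => Finset.sum_congr rfl fun b _ => ?_
    ring
  have comm3 : ∀ {ι : Type} [Fintype ι] (f : Fin 4 → Fin 4 → ι → ℝ),
      ∑ a, ∑ b, ∑ i, f a b i = ∑ i, ∑ a, ∑ b, f a b i := by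
    intro ι _ f
    rw [Finset.sum_comm (γ := ι)]
    exact Finset.sum_congr rfl fun a _ => Finset.sum_comm
  simp only [pullback, key', sum_fin_succ_pi, Fin.prod_univ_succ (n := k + 1),
    Fin.prod_univ_succ (n := k), Fin.cons_zero, Fin.cons_succ, Finset.mul_sum, Finset.sum_mul]
  rw [← comm3]
  refine Eq.trans ?_ (comm3 _).symm
  refine Finset.sum_congr rfl fun c _ => Eq.trans ?_ (comm3 _).symm
  refine Finset.sum_congr rfl fun d _ => Eq.trans ?_ (comm3 _).symm
  refine Finset.sum_congr rfl fun J _ => Finset.sum_congr rfl fun a _ =>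
    Finset.sum_congr rfl fun b _ => ?_
  ring

/-- Tensors constructed from the metric and the curvature are equivariant. -/
theorem TensorExpr.eval_pull {P g : Matrix (Fin 4) (Fin 4) ℝ} (hP : IsUnit P.det) (R W : Tensor4)
    {k : ℕ} (T : TensorExpr k) (I : Fin k → Fin 4) :
    T.eval (P.transpose * g * P) (R.pull P) (W.pull P) I = pullback P (T.eval g R W) I := by
  induction T with
  | metric => exact (pullback_rank_two P g I).symm
  | riemann => exact (pullback_rank_four P R I).symm
  | weyl => exact (pullback_rank_four P W I).symm
  | smul c S ih =>
    simp only [TensorExpr.eval, ih, pullback, Finset.mul_sum]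
    exact Finset.sum_congr rfl fun J _ => by ring
  | add S T ihS ihT =>
    simp only [TensorExpr.eval, ihS, ihT, pullback, mul_add, Finset.sum_add_distrib]
  | tprod S T ihS ihT =>
    simp only [TensorExpr.eval, ihS, ihT]
    exact (pullback_tprod P _ _ I).symm
  | perm σ S ih =>
    simp only [TensorExpr.eval, ih]
    exact (pullback_perm P σ _ I).symm
  | contract S ih =>
    simp only [TensorExpr.eval, ih]
    exact (pullback_contract hP _ I).symm

/-- Tensors constructed from the metric and the curvature depend differentiably on the latter. -/
theorem TensorExpr.differentiable_eval (g : Matrix (Fin 4) (Fin 4) ℝ) {R W : ℝ → Tensor4}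
    (hR : ∀ a b c d, Differentiable ℝ fun s => R s a b c d)
    (hW : ∀ a b c d, Differentiable ℝ fun s => W s a b c d)
    {k : ℕ} (T : TensorExpr k) (I : Fin k → Fin 4) :
    Differentiable ℝ fun s => T.eval g (R s) (W s) I := by
  induction T with
  | metric => exact differentiable_const _
  | riemann => exact hR _ _ _ _
  | weyl => exact hW _ _ _ _
  | smul c S ih => exact (ih I).const_mul c
  | add S T ihS ihT => exact (ihS I).add (ihT I)
  | tprod S T ihS ihT => exact (ihS _).mul (ihT _)
  | perm σ S ih => exact ih _
  | contract S ih =>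
    exact Differentiable.fun_sum fun a _ => Differentiable.fun_sum fun b _ =>
      (ih _).const_mul _

/-! ### Algebraic Weyl tensors -/

/-- The algebraic symmetries of a Weyl tensor for the metric `g`. -/
structure IsWeyl (g : Matrix (Fin 4) (Fin 4) ℝ) (W : Tensor4) : Prop where
  antisymm_left : ∀ a b c d, W a b c d = -W b a c d
  antisymm_right : ∀ a b c d, W a b c d = -W a b d c
  pair : ∀ a b c d, W a b c d = W c d a b
  bianchi : ∀ a b c d, W a b c d + W a c d b + W a d b c = 0
  trace : ∀ b d, ∑ a, ∑ c, g⁻¹ a c * W a b c d = 0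

theorem IsWeyl.sub {g : Matrix (Fin 4) (Fin 4) ℝ} {W V : Tensor4} (hW : IsWeyl g W)
    (hV : IsWeyl g V) : IsWeyl g (fun a b c d => W a b c d - V a b c d) where
  antisymm_left a b c d := by rw [hW.antisymm_left, hV.antisymm_left]; ring
  antisymm_right a b c d := by rw [hW.antisymm_right, hV.antisymm_right]; ring
  pair a b c d := by rw [hW.pair, hV.pair]
  bianchi a b c d := by linear_combination hW.bianchi a b c d - hV.bianchi a b c d
  trace b d := by simp only [mul_sub, Finset.sum_sub_distrib, hW.trace, hV.trace, sub_zero]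

/-- An equation between tensors constructed from the metric and the curvature holds in every
frame. -/
theorem TensorExpr.eval_pull_eq_zero {P g : Matrix (Fin 4) (Fin 4) ℝ} (hP : IsUnit P.det)
    {R W : Tensor4} {k : ℕ} (T : TensorExpr k) (h : ∀ I, T.eval g R W I = 0) (I : Fin k → Fin 4) :
    T.eval (P.transpose * g * P) (R.pull P) (W.pull P) I = 0 := by
  simp [T.eval_pull hP, pullback, h]

/-- Each symmetry is the vanishing of a tensor expression in the metric and `W`, so equivariance
carries it to the new frame. -/
theorem IsWeyl.pull {P g : Matrix (Fin 4) (Fin 4) ℝ} (hP : IsUnit P.det) {W : Tensor4}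
    (hW : IsWeyl g W) : IsWeyl (P.transpose * g * P) (W.pull P) where
  antisymm_left a b c d := by
    have := TensorExpr.eval_pull_eq_zero (g := g) (R := W) (W := W) hP
      (.add .weyl (.perm (Equiv.swap 0 1) .weyl)) (fun I => ?_) ![a, b, c, d]
    · exact eq_neg_of_add_eq_zero_left this
    · exact eq_neg_iff_add_eq_zero.1 (hW.antisymm_left _ _ _ _)
  antisymm_right a b c d := by
    have := TensorExpr.eval_pull_eq_zero (g := g) (R := W) (W := W) hP
      (.add .weyl (.perm (Equiv.swap 2 3) .weyl)) (fun I => ?_) ![a, b, c, d]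
    · exact eq_neg_of_add_eq_zero_left this
    · exact eq_neg_iff_add_eq_zero.1 (hW.antisymm_right _ _ _ _)
  pair a b c d := by
    have := TensorExpr.eval_pull_eq_zero (g := g) (R := W) (W := W) hP
      (.add .weyl (.smul (-1) (.perm (Equiv.swap 0 2 * Equiv.swap 1 3) .weyl))) (fun I => ?_)
      ![a, b, c, d]
    · have h : W.pull P a b c d + -1 * W.pull P c d a b = 0 := this
      linarith
    · change W _ _ _ _ + -1 * W (I 2) (I 3) (I 0) (I 1) = 0
      rw [hW.pair]; ring
  bianchi a b c d := by
    have := TensorExpr.eval_pull_eq_zero (g := g) (R := W) (W := W) hP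
      (.add (.add .weyl (.perm (Equiv.swap 1 2 * Equiv.swap 2 3) .weyl))
        (.perm (Equiv.swap 1 3 * Equiv.swap 2 3) .weyl)) (fun I => ?_)
      ![a, b, c, d]
    · exact this
    · exact hW.bianchi _ _ _ _
  trace b d := by
    have := TensorExpr.eval_pull_eq_zero (g := g) (R := W) (W := W) hP
      (.contract (.perm (Equiv.swap 1 2) .weyl)) (fun I => ?_) ![b, d]
    · exact this
    · exact hW.trace (I 0) (I 1)

/-! ### The frame model

Frame indices stand for `ℓ, n, m, m̃` in this order, and correspond to the pairs `00, 11, 01, 10`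
of an unprimed and a primed spinor index. -/

/-- The unprimed spinor index. -/
def spinIdx : Fin 4 → Fin 5 := ![0, 1, 0, 1]

/-- The primed spinor index. -/
def spinIdx' : Fin 4 → Fin 5 := ![0, 1, 1, 0]

/-- The area form on unprimed spinors. -/
def eps (a b : Fin 4) : ℝ := (![0, 1, 0, 1] : Fin 4 → ℝ) b - (![0, 1, 0, 1] : Fin 4 → ℝ) a

/-- The area form on primed spinors. -/
def eps' (a b : Fin 4) : ℝ := (![0, 1, 1, 0] : Fin 4 → ℝ) b - (![0, 1, 1, 0] : Fin 4 → ℝ) a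

/-- The metric in a null tetrad. -/
def eta : Matrix (Fin 4) (Fin 4) ℝ := !![0, 1, 0, 0; 1, 0, 0, 0; 0, 0, 0, -1; 0, 0, -1, 0]

/-- The Weyl tensor, in a null tetrad, with components `ψ` and `ψ'`. -/
def weylSpin (ψ ψ' : Fin 5 → ℝ) : Tensor4 := fun a b c d =>
  ψ (spinIdx a + spinIdx b + spinIdx c + spinIdx d) * eps' a b * eps' c d +
    ψ' (spinIdx' a + spinIdx' b + spinIdx' c + spinIdx' d) * eps a b * eps c d

/-- The components `Ψ₀, …, Ψ₄` of a tensor given in a null tetrad. -/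
def framePsi (W : Tensor4) : Fin 5 → ℝ :=
  ![W 0 2 0 2, W 0 2 0 1, W 0 2 3 1, W 0 1 3 1, W 1 3 1 3]

/-- The components `Ψ̃₀, …, Ψ̃₄` of a tensor given in a null tetrad. -/
def framePsi' (W : Tensor4) : Fin 5 → ℝ :=
  ![W 0 3 0 3, W 0 3 0 1, W 0 3 2 1, W 0 1 2 1, W 1 2 1 2]

theorem eta_mul_eta : eta * eta = 1 := by
  ext i j
  fin_cases i <;> fin_cases j <;> simp [eta, Matrix.mul_apply, Fin.sum_univ_four]

theorem eta_inv : eta⁻¹ = eta := Matrix.inv_eq_left_inv eta_mul_eta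

theorem eta_contract (W : Tensor4) (b d : Fin 4) :
    ∑ a, ∑ c, eta⁻¹ a c * W a b c d = W 0 b 1 d + W 1 b 0 d - W 2 b 3 d - W 3 b 2 d := by
  rw [eta_inv]
  simp [eta, Fin.sum_univ_four]
  ring

/-- This is the spinor form `ψ_{ABCD} ε_{A'B'} ε_{C'D'}` plus its primed counterpart. Total symmetry
of a spinor is encoded by dependence on the sum of the indices, which is at most 4 and so does not
wrap around in `Fin 5`. The Bianchi identity is the cyclic identity of an area form. -/
theorem weylSpin_isWeyl (ψ ψ' : Fin 5 → ℝ) : IsWeyl eta (weylSpin ψ ψ') where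
  antisymm_left a b c d := by
    simp only [weylSpin, eps, eps', add_comm (spinIdx b), add_comm (spinIdx' b)]
    ring
  antisymm_right a b c d := by
    simp only [weylSpin, eps, eps', add_right_comm _ (spinIdx d), add_right_comm _ (spinIdx' d)]
    ring
  pair a b c d := by
    have h : ∀ s : Fin 4 → Fin 5, s c + s d + s a + s b = s a + s b + s c + s d := by
      intro s; abel
    simp only [weylSpin, eps, eps', h]
    ring
  bianchi a b c d := by
    have h : ∀ s : Fin 4 → Fin 5, s a + s c + s d + s b = s a + s b + s c + s d := by
      intro s; abel
    have h' : ∀ s : Fin 4 → Fin 5, s a + s d + s b + s c = s a + s b + s c + s d := by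
      intro s; abel
    simp only [weylSpin, eps, eps', h, h']
    ring
  trace b d := by
    rw [eta_contract]
    fin_cases b <;> fin_cases d <;> simp [weylSpin, eps, eps', spinIdx, spinIdx', add_comm]

theorem framePsi_weylSpin (ψ ψ' : Fin 5 → ℝ) : framePsi (weylSpin ψ ψ') = ψ := by
  ext i
  fin_cases i <;> simp [framePsi, weylSpin, eps, eps', spinIdx]

theorem framePsi'_weylSpin (ψ ψ' : Fin 5 → ℝ) : framePsi' (weylSpin ψ ψ') = ψ' := by
  ext i
  fin_cases i <;> simp [framePsi', weylSpin, eps, eps', spinIdx']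

/-- Antisymmetry and pair symmetry leave 21 components; one Bianchi identity and ten trace equations
reduce them to 10, which are exactly the five `Ψ` and five `Ψ̃`. -/
theorem IsWeyl.eq_zero {D : Tensor4} (hD : IsWeyl eta D) (h : framePsi D = 0)
    (h' : framePsi' D = 0) : ∀ a b c d, D a b c d = 0 := by
  have p : ∀ i, framePsi D i = 0 := fun i => congrFun h i
  have p' : ∀ i, framePsi' D i = 0 := fun i => congrFun h' i
  have p0 : D 0 2 0 2 = 0 := p 0
  have p1 : D 0 2 0 1 = 0 := p 1
  have p2 : D 0 2 3 1 = 0 := p 2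
  have p3 : D 0 1 3 1 = 0 := p 3
  have p4 : D 1 3 1 3 = 0 := p 4
  have q0 : D 0 3 0 3 = 0 := p' 0
  have q1 : D 0 3 0 1 = 0 := p' 1
  have q2 : D 0 3 2 1 = 0 := p' 2
  have q3 : D 0 1 2 1 = 0 := p' 3
  have q4 : D 1 2 1 2 = 0 := p' 4
  have tr : ∀ b d, D 0 b 1 d + D 1 b 0 d - D 2 b 3 d - D 3 b 2 d = 0 := fun b d => by
    rw [← eta_contract, hD.trace]
  have s0 : ∀ a c d, D a a c d = 0 := fun a c d => by linarith [hD.antisymm_left a a c d]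
  have t0 : ∀ a c d, D c d a a = 0 := fun a c d => by linarith [hD.antisymm_right c d a a]
  have s10 := hD.antisymm_left 1 0
  have s20 := hD.antisymm_left 2 0
  have s30 := hD.antisymm_left 3 0
  have s21 := hD.antisymm_left 2 1
  have s31 := hD.antisymm_left 3 1
  have s32 := hD.antisymm_left 3 2
  have t20 := fun a b => hD.antisymm_right a b 2 0
  have t30 := fun a b => hD.antisymm_right a b 3 0
  have t21 := fun a b => hD.antisymm_right a b 2 1
  have t31 := fun a b => hD.antisymm_right a b 3 1
  have t32 := fun a b => hD.antisymm_right a b 3 2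
  have u1 := hD.pair 0 2 0 1
  have u2 := hD.pair 0 3 0 1
  have u3 := hD.pair 1 2 0 1
  have u4 := hD.pair 1 3 0 1
  have u5 := hD.pair 2 3 0 1
  have u6 := hD.pair 0 3 0 2
  have u7 := hD.pair 1 2 0 2
  have u8 := hD.pair 1 3 0 2
  have u9 := hD.pair 2 3 0 2
  have v1 := hD.pair 1 2 0 3
  have v2 := hD.pair 1 3 0 3
  have v3 := hD.pair 2 3 0 3
  have v4 := hD.pair 1 3 1 2
  have v5 := hD.pair 2 3 1 2
  have v6 := hD.pair 2 3 1 3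
  have bi := hD.bianchi 0 1 2 3
  have tr00 := tr 0 0
  have tr01 := tr 0 1
  have tr02 := tr 0 2
  have tr03 := tr 0 3
  have tr11 := tr 1 1
  have tr12 := tr 1 2
  have tr13 := tr 1 3
  have tr22 := tr 2 2
  have tr23 := tr 2 3
  have tr33 := tr 3 3
  simp only [s0, t0, s10, s20, s30, s21, s31, s32, t20, t30, t21, t31, t32]
    at p1 p2 p3 q1 q2 q3 bi tr00 tr01 tr02 tr03 tr11 tr12 tr13 tr22 tr23 tr33
  have ordered : ∀ a b c d : Fin 4, a < b → c < d → D a b c d = 0 := by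
    intro a b c d hab hcd
    fin_cases a <;> fin_cases b <;> first | (exact absurd hab (by decide)) | skip
    all_goals
      fin_cases c <;> fin_cases d <;> first | (exact absurd hcd (by decide)) | skip
    all_goals
      dsimp only [Fin.zero_eta, Fin.mk_one, Fin.reduceFinMk]
      linarith
  have right : ∀ a b c d : Fin 4, a < b → D a b c d = 0 := by
    intro a b c d hab
    rcases lt_trichotomy c d with hcd | rfl | hcd
    · exact ordered a b c d hab hcd
    · linarith [hD.antisymm_right a b c c]
    · rw [hD.antisymm_right, ordered a b d c hab hcd, neg_zero]
  intro a b c d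
  rcases lt_trichotomy a b with hab | rfl | hab
  · exact right a b c d hab
  · linarith [hD.antisymm_left a a c d]
  · rw [hD.antisymm_left, right b a c d hab, neg_zero]

/-- A Weyl tensor is determined by its components in a null tetrad. -/
theorem IsWeyl.eq_weylSpin {W : Tensor4} (hW : IsWeyl eta W) :
    W = weylSpin (framePsi W) (framePsi' W) := by
  have hψ := framePsi_weylSpin (framePsi W) (framePsi' W)
  have hψ' := framePsi'_weylSpin (framePsi W) (framePsi' W)
  generalize hV : weylSpin (framePsi W) (framePsi' W) = V at hψ hψ'
  have h := (hW.sub (hV ▸ weylSpin_isWeyl _ _)).eq_zero ?_ ?_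
  · funext a b c d
    exact sub_eq_zero.1 (h a b c d)
  · ext i
    have := congrFun hψ i
    fin_cases i <;> exact sub_eq_zero.2 this.symm
  · ext i
    have := congrFun hψ' i
    fin_cases i <;> exact sub_eq_zero.2 this.symm

/-! ### Tensors constructed from the curvature of an Einstein metric, in a null tetrad -/

/-- The Riemann tensor of an Einstein metric `g` with `R_{ab} = lam g_{ab}` and Weyl tensor `W`. -/
def einsteinRiemann (lam : ℝ) (g : Matrix (Fin 4) (Fin 4) ℝ) (W : Tensor4) : Tensor4 :=
  fun a b c d => W a b c d + lam / 3 * (g a c * g b d - g a d * g b c)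

/-- The right-hand side of the definition is itself a tensor expression `K` in the metric and the
Weyl tensor, so this is an instance of `TensorExpr.eval_pull`. -/
theorem einsteinRiemann_pull {P g : Matrix (Fin 4) (Fin 4) ℝ} (hP : IsUnit P.det) (lam : ℝ)
    (W : Tensor4) : (einsteinRiemann lam g W).pull P =
      einsteinRiemann lam (P.transpose * g * P) (W.pull P) := by
  funext a b c d
  let K : TensorExpr 4 := .add .weyl (.smul (lam / 3) (.add
    (.perm (Equiv.swap 1 2) (.tprod .metric .metric))
    (.smul (-1) (.perm (Equiv.swap 1 3 * Equiv.swap 2 3) (.tprod .metric .metric)))))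
  have hK : ∀ (h : Matrix (Fin 4) (Fin 4) ℝ) (V : Tensor4) (I : Fin 4 → Fin 4),
      K.eval h V V I = einsteinRiemann lam h V (I 0) (I 1) (I 2) (I 3) := by
    intro h V I
    change V _ _ _ _ + lam / 3 * (h (I 0) (I 2) * h (I 1) (I 3) +
      -1 * (h (I 0) (I 3) * h (I 1) (I 2))) = _
    rw [einsteinRiemann]
    ring
  have h := K.eval_pull (g := g) hP W W ![a, b, c, d]
  rw [hK, funext (hK g W)] at h
  exact ((pullback_rank_four P (einsteinRiemann lam g W) ![a, b, c, d]).symm.trans h.symm)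

/-- The components, in a null tetrad, of a rank-2 tensor constructed from the curvature of an
Einstein metric. -/
def TensorExpr.frameEval (T : TensorExpr 2) (lam : ℝ) (ψ ψ' : Fin 5 → ℝ) :
    Matrix (Fin 4) (Fin 4) ℝ := fun i j =>
  T.eval eta (einsteinRiemann lam eta (weylSpin ψ ψ')) (weylSpin ψ ψ') ![i, j]

theorem isUnit_det_of_frame {P g : Matrix (Fin 4) (Fin 4) ℝ}
    (h : P.transpose * g * P = eta) : IsUnit P.det := by
  have h1 := congrArg Matrix.det eta_mul_eta
  rw [Matrix.det_mul, Matrix.det_one, ← h, Matrix.det_mul] at h1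
  exact IsUnit.of_mul_eq_one ((P.transpose * g).det * ((P.transpose * g).det * P.det))
    (by linarith)

/-- Equivariance combined with the reconstruction `IsWeyl.eq_weylSpin`: this passes from the metric
at a point to the frame model. -/
theorem TensorExpr.frameEval_eq (T : TensorExpr 2) {P g : Matrix (Fin 4) (Fin 4) ℝ}
    (h : P.transpose * g * P = eta) {W : Tensor4} (hW : IsWeyl g W) (lam : ℝ) :
    T.frameEval lam (framePsi (W.pull P)) (framePsi' (W.pull P)) =
      P.transpose * (Matrix.of fun i j => T.eval g (einsteinRiemann lam g W) W ![i, j]) * P := by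
  have hP := isUnit_det_of_frame h
  have hWP := hW.pull hP
  rw [h] at hWP
  ext i j
  have h1 := T.eval_pull (g := g) hP (einsteinRiemann lam g W) W ![i, j]
  rw [einsteinRiemann_pull hP, h] at h1
  rw [TensorExpr.frameEval, ← hWP.eq_weylSpin, h1]
  refine Eq.trans ?_ (pullback_rank_two P
    (Matrix.of fun i j => T.eval g (einsteinRiemann lam g W) W ![i, j]) ![i, j])
  congr 1
  funext J
  rw [Matrix.of_apply]
  congr 1
  ext i
  fin_cases i <;> rfl

/-- The action on `frameEval` of a change of null tetrad. -/
theorem TensorExpr.frameEval_isometry (T : TensorExpr 2) {P : Matrix (Fin 4) (Fin 4) ℝ}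
    (h : P.transpose * eta * P = eta) (lam : ℝ) {ψ ψ' φ φ' : Fin 5 → ℝ}
    (hφ : framePsi ((weylSpin ψ ψ').pull P) = φ) (hφ' : framePsi' ((weylSpin ψ ψ').pull P) = φ') :
    T.frameEval lam φ φ' = P.transpose * T.frameEval lam ψ ψ' * P := by
  rw [← hφ, ← hφ']
  exact T.frameEval_eq h (weylSpin_isWeyl ψ ψ') lam

/-! ### Changes of null tetrad acting on primed spinors -/

/-- The boost `ℓ, m̃ ↦ t⁻¹ ℓ, t⁻¹ m̃` and `n, m ↦ t n, t m`. -/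
def boost (t : ℝ) : Matrix (Fin 4) (Fin 4) ℝ := Matrix.diagonal ![t⁻¹, t, t, t⁻¹]

/-- The null rotation `n, m ↦ n + z m̃, m + z ℓ`. -/
def nullRotation (z : ℝ) : Matrix (Fin 4) (Fin 4) ℝ :=
  !![1, 0, z, 0; 0, 1, 0, 0; 0, 0, 1, 0; 0, z, 0, 1]

/-- The exchange `ℓ, n, m, m̃ ↦ m, -m̃, -ℓ, n`. -/
def exchange : Matrix (Fin 4) (Fin 4) ℝ :=
  !![0, 0, -1, 0; 0, 0, 0, 1; 1, 0, 0, 0; 0, -1, 0, 0]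

theorem boost_isometry {t : ℝ} (ht : t ≠ 0) :
    (boost t).transpose * eta * boost t = eta := by
  ext i j
  simp only [boost, Matrix.diagonal_transpose, Matrix.mul_diagonal, Matrix.diagonal_mul]
  fin_cases i <;> fin_cases j <;> simp [eta, ht]

theorem nullRotation_isometry (z : ℝ) :
    (nullRotation z).transpose * eta * nullRotation z = eta := by
  ext i j
  fin_cases i <;> fin_cases j <;>
    simp [eta, nullRotation, Matrix.mul_apply, Fin.sum_univ_four]

theorem exchange_isometry : exchange.transpose * eta * exchange = eta := by
  ext i j
  fin_cases i <;> fin_cases j <;>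
    simp [eta, exchange, Matrix.mul_apply, Fin.sum_univ_four]

/-- The boost, the null rotation and the exchange have determinant one on primed spinors and are
trivial on unprimed ones, which is why none of them moves `Ψ`. -/
theorem framePsi_boost {t : ℝ} (ht : t ≠ 0) (ψ ψ' : Fin 5 → ℝ) :
    framePsi ((weylSpin ψ ψ').pull (boost t)) = ψ := by
  ext i
  fin_cases i <;>
    simp [framePsi, Tensor4.pull, Tensor4.contr, Matrix.col, boost,
      weylSpin, eps, eps', spinIdx, Matrix.diagonal_apply] <;> field_simp

/-- `Ψ̃ₖ` has boost weight `2 * k - 4`. -/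
theorem framePsi'_boost {t : ℝ} (ht : t ≠ 0) (ψ : Fin 5 → ℝ) (c y : ℝ) :
    framePsi' ((weylSpin ψ ![0, 0, c, 0, y]).pull (boost t)) = ![0, 0, c, 0, t ^ 4 * y] := by
  ext i
  fin_cases i <;>
    simp [framePsi', Tensor4.pull, Tensor4.contr, Matrix.col, boost,
      weylSpin, eps, eps', spinIdx', Matrix.diagonal_apply] <;> field_simp

theorem framePsi_exchange (ψ ψ' : Fin 5 → ℝ) :
    framePsi ((weylSpin ψ ψ').pull exchange) = ψ := by
  ext i
  fin_cases i <;>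
    simp [framePsi, Tensor4.pull, Tensor4.contr, Fin.sum_univ_four, Matrix.col, exchange,
      weylSpin, eps, eps', spinIdx, spinIdx']

theorem framePsi'_exchange (ψ : Fin 5 → ℝ) (c : ℝ) :
    framePsi' ((weylSpin ψ ![0, 0, c, 0, 0]).pull exchange) = ![0, 0, c, 0, 0] := by
  ext i
  fin_cases i <;>
    simp [framePsi', Tensor4.pull, Tensor4.contr, Fin.sum_univ_four, Matrix.col, exchange,
      weylSpin, eps, eps', spinIdx, spinIdx']

theorem framePsi_nullRotation (ψ ψ' : Fin 5 → ℝ) (z : ℝ) :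
    framePsi ((weylSpin ψ ψ').pull (nullRotation z)) = ψ := by
  ext i
  fin_cases i <;>
    simp [framePsi, Tensor4.pull, Tensor4.contr, Fin.sum_univ_four, Matrix.col, nullRotation,
      weylSpin, eps, eps', spinIdx, spinIdx']

/-- Binomial expansion of a quartic form after adding `z` times the first primed basis spinor to the
second; the higher powers of `z` carry `Ψ̃₀` and `Ψ̃₁`, which vanish here. -/
theorem framePsi'_nullRotation (ψ : Fin 5 → ℝ) (c b y z : ℝ) :
    framePsi' ((weylSpin ψ ![0, 0, c, b, y]).pull (nullRotation z)) =
      ![0, 0, c, b + 3 * z * c, y + 4 * z * b + 6 * z ^ 2 * c] := by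
  ext i
  fin_cases i <;>
    simp [framePsi', Tensor4.pull, Tensor4.contr, Fin.sum_univ_four, Matrix.col, nullRotation,
      weylSpin, eps, eps', spinIdx, spinIdx'] <;> ring

/-! ### Functions of `Ψ̃₄` that are homogeneous under boosts -/

open Filter Topology

theorem eq_apply_zero_of_weight_zero {f : ℝ → ℝ} (hf : Continuous f) {y : ℝ}
    (h : ∀ t ≠ 0, f (t ^ 4 * y) = f y) : f y = f 0 := by
  have h1 : Tendsto (fun t : ℝ => f (t ^ 4 * y)) (𝓝[≠] 0) (𝓝 (f 0)) := by
    have : Continuous fun t : ℝ => f (t ^ 4 * y) := by fun_prop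
    simpa using (this.tendsto 0).mono_left nhdsWithin_le_nhds
  refine tendsto_nhds_unique ((tendsto_congr' ?_).1 tendsto_const_nhds) h1
  filter_upwards [self_mem_nhdsWithin] with t ht using (h t ht).symm

theorem eq_zero_of_weight_neg {f : ℝ → ℝ} (hf : Continuous f) {y : ℝ}
    (h : ∀ t ≠ 0, f (t ^ 4 * y) = t⁻¹ * t⁻¹ * f y) : f y = 0 := by
  have h1 : Tendsto (fun t : ℝ => t ^ 2 * f (t ^ 4 * y)) (𝓝[≠] 0) (𝓝 0) := by
    have : Continuous fun t : ℝ => t ^ 2 * f (t ^ 4 * y) := by fun_prop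
    simpa using (this.tendsto 0).mono_left nhdsWithin_le_nhds
  refine tendsto_nhds_unique ((tendsto_congr' ?_).1 tendsto_const_nhds) h1
  filter_upwards [self_mem_nhdsWithin] with t ht
  have ht : t ≠ 0 := ht
  rw [h t ht]
  field_simp

/-- Continuity would not suffice, as a square root scales in this way. The scaling gives `f 0 = 0`,
and then `f y` is `t ^ 2` times the difference quotient of `w ↦ f (w * y)` at `w = t ^ 4`, which
tends to `0` times a derivative. -/
theorem eq_zero_of_weight_pos {f : ℝ → ℝ} (hf : Differentiable ℝ f) {y : ℝ}
    (h : ∀ t ≠ 0, f (t ^ 4 * y) = t * t * f y) : f y = 0 := by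
  have hc := hf.continuous
  have f0 : f 0 = 0 := by
    have h1 : Tendsto (fun t : ℝ => f (t ^ 4 * y) - t * t * f y) (𝓝[≠] 0) (𝓝 (f 0)) := by
      have : Continuous fun t : ℝ => f (t ^ 4 * y) - t * t * f y := by fun_prop
      simpa using (this.tendsto 0).mono_left nhdsWithin_le_nhds
    refine (tendsto_nhds_unique ((tendsto_congr' ?_).1 tendsto_const_nhds) h1).symm
    filter_upwards [self_mem_nhdsWithin] with t ht
    rw [h t ht, sub_self]
  have hd : HasDerivAt (fun w => f (w * y)) (deriv (fun w => f (w * y)) 0) 0 := by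
    have : Differentiable ℝ fun w => f (w * y) := by fun_prop
    exact (this 0).hasDerivAt
  have h4 : Tendsto (fun t : ℝ => t ^ 4) (𝓝[≠] 0) (𝓝[≠] 0) := by
    refine tendsto_nhdsWithin_iff.2 ⟨?_, ?_⟩
    · have : Continuous fun t : ℝ => t ^ 4 := by fun_prop
      simpa using (this.tendsto 0).mono_left nhdsWithin_le_nhds
    · filter_upwards [self_mem_nhdsWithin] with t ht using pow_ne_zero 4 ht
  have h2 : Tendsto (fun t : ℝ => t ^ 2) (𝓝[≠] 0) (𝓝 0) := by
    have : Continuous fun t : ℝ => t ^ 2 := by fun_prop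
    simpa using (this.tendsto 0).mono_left nhdsWithin_le_nhds
  have h1 := h2.mul ((hasDerivAt_iff_tendsto_slope.1 hd).comp h4)
  rw [zero_mul] at h1
  refine tendsto_nhds_unique ((tendsto_congr' ?_).1 tendsto_const_nhds) h1
  filter_upwards [self_mem_nhdsWithin] with t ht
  have ht : t ≠ 0 := ht
  simp only [Function.comp, slope, vsub_eq_sub, sub_zero, zero_mul, f0, h t ht, smul_eq_mul]
  field_simp

theorem TensorExpr.differentiable_frameEval (T : TensorExpr 2) (lam : ℝ) (ψ : Fin 5 → ℝ)
    {φ : ℝ → Fin 5 → ℝ} (hφ : ∀ i, Differentiable ℝ fun s => φ s i) (i j : Fin 4) :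
    Differentiable ℝ fun s => T.frameEval lam ψ (φ s) i j := by
  have hW : ∀ a b c d, Differentiable ℝ fun s => weylSpin ψ (φ s) a b c d := fun a b c d =>
    (((hφ _).mul_const _).mul_const _).const_add _
  exact T.differentiable_eval eta (fun a b c d => (hW a b c d).add_const _) hW _

/-! ### Symmetric rank-2 tensors are multiples of the metric -/

/-- For a Weyl tensor with `Ψ̃₀ = Ψ̃₁ = Ψ̃₃ = 0`, boosts show that a symmetric rank-2 tensor
constructed from the curvature is a multiple of the metric. -/
theorem TensorExpr.frameEval_eq_smul_eta_of_psi3_eq_zero (T : TensorExpr 2) (lam : ℝ)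
    (ψ : Fin 5 → ℝ)
    (hT : ∀ ψ' i j, T.frameEval lam ψ ψ' i j = T.frameEval lam ψ ψ' j i) (c y : ℝ) :
    T.frameEval lam ψ ![0, 0, c, 0, y] = T.frameEval lam ψ ![0, 0, c, 0, 0] 0 1 • eta := by
  set E : ℝ → Matrix (Fin 4) (Fin 4) ℝ := fun y => T.frameEval lam ψ ![0, 0, c, 0, y] with hE
  have sym : ∀ y i j, E y i j = E y j i := fun y => hT _
  have diff : ∀ i j, Differentiable ℝ fun y => E y i j := fun i j =>
    T.differentiable_frameEval lam ψ (fun k => by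
      fin_cases k <;> simp) i j
  have cont : ∀ i j, Continuous fun y => E y i j := fun i j => (diff i j).continuous
  have hb : ∀ i j t, t ≠ 0 → E (t ^ 4 * y) i j =
      (![t⁻¹, t, t, t⁻¹] : Fin 4 → ℝ) i * E y i j * (![t⁻¹, t, t, t⁻¹] : Fin 4 → ℝ) j := by
    intro i j t ht
    have := T.frameEval_isometry (boost_isometry ht) lam (framePsi_boost ht ψ _)
      (framePsi'_boost ht ψ c y)
    have := congrFun (congrFun this i) j
    simpa only [boost, Matrix.diagonal_transpose, Matrix.mul_diagonal, Matrix.diagonal_mul]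
      using this
  -- The exchange maps `Ψ̃ₖ` to `Ψ̃₄₋ₖ` up to sign and fixes `Ψ̃₂`; with `Ψ̃₄ = 0` as well it
  -- preserves the whole Weyl tensor.
  have hx : E 0 = exchange.transpose * E 0 * exchange :=
    T.frameEval_isometry exchange_isometry lam (framePsi_exchange ψ _) (framePsi'_exchange ψ c)
  have x01 : E 0 0 1 = -E 0 2 3 := by
    have := congrFun (congrFun hx 0) 1
    simpa [exchange, Matrix.mul_apply, Fin.sum_univ_four] using this
  have x02 : E 0 0 2 = -E 0 2 0 := by
    have := congrFun (congrFun hx 0) 2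
    simpa [exchange, Matrix.mul_apply, Fin.sum_univ_four] using this
  have x13 : E 0 1 3 = -E 0 3 1 := by
    have := congrFun (congrFun hx 1) 3
    simpa [exchange, Matrix.mul_apply, Fin.sum_univ_four] using this
  have w0 : ∀ i j, (∀ t : ℝ, t ≠ 0 → (![t⁻¹, t, t, t⁻¹] : Fin 4 → ℝ) i *
      (![t⁻¹, t, t, t⁻¹] : Fin 4 → ℝ) j = 1) → E y i j = E 0 i j := by
    intro i j hw
    refine eq_apply_zero_of_weight_zero (cont i j) fun t ht => ?_
    rw [hb i j t ht, mul_right_comm, hw t ht, one_mul]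
  have wneg : ∀ i j, (∀ t : ℝ, t ≠ 0 → (![t⁻¹, t, t, t⁻¹] : Fin 4 → ℝ) i *
      (![t⁻¹, t, t, t⁻¹] : Fin 4 → ℝ) j = t⁻¹ * t⁻¹) → E y i j = 0 := by
    intro i j hw
    refine eq_zero_of_weight_neg (f := fun y => E y i j) (cont i j) fun t ht => ?_
    rw [hb i j t ht, mul_right_comm, hw t ht]
  have wpos : ∀ i j, (∀ t : ℝ, t ≠ 0 → (![t⁻¹, t, t, t⁻¹] : Fin 4 → ℝ) i *
      (![t⁻¹, t, t, t⁻¹] : Fin 4 → ℝ) j = t * t) → E y i j = 0 := by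
    intro i j hw
    refine eq_zero_of_weight_pos (f := fun y => E y i j) (diff i j) fun t ht => ?_
    rw [hb i j t ht, mul_right_comm, hw t ht]
  have e00 : E y 0 0 = 0 := wneg 0 0 fun t ht => rfl
  have e03 : E y 0 3 = 0 := wneg 0 3 fun t ht => rfl
  have e33 : E y 3 3 = 0 := wneg 3 3 fun t ht => rfl
  have e11 : E y 1 1 = 0 := wpos 1 1 fun t ht => rfl
  have e12 : E y 1 2 = 0 := wpos 1 2 fun t ht => rfl
  have e22 : E y 2 2 = 0 := wpos 2 2 fun t ht => rfl
  have e01 : E y 0 1 = E 0 0 1 := w0 0 1 fun t ht => inv_mul_cancel₀ ht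
  -- The exchange makes this weight-zero entry antisymmetric at `0`, against the symmetry of `E 0`.
  have e02 : E y 0 2 = 0 := by
    rw [w0 0 2 fun t ht => inv_mul_cancel₀ ht]
    linarith [sym 0 0 2]
  have e13 : E y 1 3 = 0 := by
    rw [w0 1 3 fun t ht => mul_inv_cancel₀ ht]
    linarith [sym 0 1 3]
  have e23 : E y 2 3 = -E 0 0 1 := by
    rw [w0 2 3 fun t ht => mul_inv_cancel₀ ht]
    linarith
  change E y = E 0 0 1 • eta
  ext i j
  fin_cases i <;> fin_cases j <;>
    simp [eta, e00, e01, e02, e03, e11, e12, e13, e22, e23, e33, sym y 1 0, sym y 2 0, sym y 3 0,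
      sym y 2 1, sym y 3 1, sym y 3 2]

theorem conjugate_cancel {P M N : Matrix (Fin 4) (Fin 4) ℝ} (hP : IsUnit P.det)
    (h : P.transpose * M * P = P.transpose * N * P) : M = N := by
  have hu : IsUnit P := (Matrix.isUnit_iff_isUnit_det P).2 hP
  have hu' : IsUnit P.transpose := (Matrix.isUnit_iff_isUnit_det _).2 (by
    rwa [Matrix.det_transpose])
  exact hu'.mul_left_cancel (hu.mul_right_cancel h)

/-- For a Weyl tensor with `Ψ̃₀ = Ψ̃₁ = 0`, a symmetric rank-2 tensor constructed from the
curvature is a multiple of the metric, and the factor does not depend on `Ψ̃₃` and `Ψ̃₄`. -/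
theorem TensorExpr.frameEval_eq_smul_eta (T : TensorExpr 2) (lam : ℝ) (ψ : Fin 5 → ℝ)
    (hT : ∀ ψ' i j, T.frameEval lam ψ ψ' i j = T.frameEval lam ψ ψ' j i) (c b y : ℝ) :
    T.frameEval lam ψ ![0, 0, c, b, y] = T.frameEval lam ψ ![0, 0, c, 0, 0] 0 1 • eta := by
  have generic : ∀ s ≠ 0, T.frameEval lam ψ ![0, 0, s, b, y] =
      T.frameEval lam ψ ![0, 0, s, 0, 0] 0 1 • eta := by
    intro s hs
    -- The parameter solves `b + 3 * z * s = 0`, so that the rotated tetrad has `Ψ̃₃ = 0`.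
    have h := framePsi'_nullRotation ψ s b y (-(b / (3 * s)))
    rw [show b + 3 * -(b / (3 * s)) * s = 0 by field_simp; ring] at h
    have h1 := T.frameEval_isometry (nullRotation_isometry _) lam (framePsi_nullRotation ψ _ _) h
    rw [T.frameEval_eq_smul_eta_of_psi3_eq_zero lam ψ hT] at h1
    refine conjugate_cancel (isUnit_det_of_frame (nullRotation_isometry _)) (h1.symm.trans ?_)
    rw [Matrix.mul_smul, Matrix.smul_mul, nullRotation_isometry]
  ext i j
  have hl : Continuous fun s => T.frameEval lam ψ ![0, 0, s, b, y] i j :=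
    (T.differentiable_frameEval lam ψ (fun k => by fin_cases k <;> simp) i j).continuous
  have hr : Continuous fun s => (T.frameEval lam ψ ![0, 0, s, 0, 0] 0 1 • eta) i j := by
    have := (T.differentiable_frameEval lam ψ (φ := fun s => ![0, 0, s, 0, 0])
      (fun k => by fin_cases k <;> simp) 0 1).continuous
    exact this.mul continuous_const
  -- Both sides are continuous in `Ψ̃₂`, so the identity extends from `Ψ̃₂ ≠ 0` to `Ψ̃₂ = 0`, where
  -- no null rotation can change `Ψ̃₃`.
  have hd : Dense ({0}ᶜ : Set ℝ) := dense_compl_singleton 0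
  exact congrFun (Continuous.ext_on hd hl hr fun s hs => by
    simp only [generic s hs]) c

/-! ### Symmetries of the curvature of a `C²` metric -/

theorem differentiableAt_pderiv {f : (Fin 4 → ℝ) → ℝ} {x : Fin 4 → ℝ} (hf : ContDiffAt ℝ 2 f x)
    (i : Fin 4) : DifferentiableAt ℝ (pderiv i f) x := by
  have h : ContDiffAt ℝ 1 (fderiv ℝ f) x := hf.fderiv_right (by norm_num)
  exact (h.differentiableAt (by norm_num)).clm_apply (differentiableAt_const _)

theorem pderiv_comm {f : (Fin 4 → ℝ) → ℝ} {x : Fin 4 → ℝ} (hf : ContDiffAt ℝ 2 f x)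
    (i j : Fin 4) : pderiv i (pderiv j f) x = pderiv j (pderiv i f) x := by
  have h : ContDiffAt ℝ 1 (fderiv ℝ f) x := hf.fderiv_right (by norm_num)
  have hd : DifferentiableAt ℝ (fderiv ℝ f) x := h.differentiableAt (by norm_num)
  have key : ∀ k l : Fin 4, pderiv k (pderiv l f) x =
      fderiv ℝ (fderiv ℝ f) x (Pi.single k 1) (Pi.single l 1) := by
    intro k l
    have := fderiv_clm_apply hd (differentiableAt_const (c := (Pi.single l 1 : Fin 4 → ℝ)))
    change fderiv ℝ (fun y => fderiv ℝ f y (Pi.single l 1)) x (Pi.single k 1) = _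
    rw [this]
    simp
  rw [key, key]
  exact hf.isSymmSndFDerivAt (by simp) _ _

theorem pderiv_sum {ι : Type*} {s : Finset ι} {f : ι → (Fin 4 → ℝ) → ℝ} {x : Fin 4 → ℝ}
    (hf : ∀ k ∈ s, DifferentiableAt ℝ (f k) x) (i : Fin 4) :
    pderiv i (fun y => ∑ k ∈ s, f k y) x = ∑ k ∈ s, pderiv i (f k) x := by
  simp [pderiv, fderiv_fun_sum hf]

theorem pderiv_mul {f h : (Fin 4 → ℝ) → ℝ} {x : Fin 4 → ℝ} (hf : DifferentiableAt ℝ f x)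
    (hh : DifferentiableAt ℝ h x) (i : Fin 4) :
    pderiv i (fun y => f y * h y) x = pderiv i f x * h x + f x * pderiv i h x := by
  simp [pderiv, fderiv_fun_mul hf hh]
  ring

/-- A field of symmetric nondegenerate matrices that is `C²` at `x`. -/
structure IsMetricAt (g : (Fin 4 → ℝ) → Matrix (Fin 4) (Fin 4) ℝ) (x : Fin 4 → ℝ) : Prop where
  symm : ∀ y a b, g y a b = g y b a
  isUnit_det : ∀ y, IsUnit (g y).det
  contDiffAt : ∀ a b, ContDiffAt ℝ 2 (fun y => g y a b) x
  differentiableAt_inv : ∀ a b, DifferentiableAt ℝ (fun y => (g y)⁻¹ a b) x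

/-- Christoffel symbols of the first kind `Γ_{abc}`. -/
def christoffelLow (g : (Fin 4 → ℝ) → Matrix (Fin 4) (Fin 4) ℝ) (a b c : Fin 4)
    (x : Fin 4 → ℝ) : ℝ :=
  (1 / 2) * (pderiv b (fun y => g y a c) x + pderiv c (fun y => g y b a) x
    - pderiv a (fun y => g y b c) x)

theorem christoffel_eq_sum (g : (Fin 4 → ℝ) → Matrix (Fin 4) (Fin 4) ℝ) (a b c : Fin 4)
    (x : Fin 4 → ℝ) : christoffel g a b c x = ∑ d, (g x)⁻¹ a d * christoffelLow g d b c x := by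
  rw [christoffel, Finset.mul_sum]
  exact Finset.sum_congr rfl fun d _ => by rw [christoffelLow]; ring

namespace IsMetricAt

variable {g : (Fin 4 → ℝ) → Matrix (Fin 4) (Fin 4) ℝ} {x : Fin 4 → ℝ}

theorem inv_symm (hg : IsMetricAt g x) (y : Fin 4 → ℝ) (a b : Fin 4) :
    (g y)⁻¹ a b = (g y)⁻¹ b a := by
  have h : (g y).transpose = g y := by
    ext i j
    exact hg.symm y j i
  have h2 := Matrix.transpose_nonsing_inv (g y)
  rw [h] at h2
  exact congrFun (congrFun h2 b) a

theorem sum_mul_inv (hg : IsMetricAt g x) (y : Fin 4 → ℝ) (a b : Fin 4) :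
    ∑ e, g y a e * (g y)⁻¹ e b = if a = b then 1 else 0 := by
  rw [← Matrix.mul_apply, Matrix.mul_nonsing_inv _ (hg.isUnit_det y), Matrix.one_apply]

theorem lower (hg : IsMetricAt g x) (y : Fin 4 → ℝ) {u v : Fin 4 → ℝ}
    (h : ∀ a, u a = ∑ e, (g y)⁻¹ a e * v e) (a : Fin 4) : ∑ e, g y a e * u e = v a := by
  have hu : u = (g y)⁻¹.mulVec v := funext h
  have := congrFun (congrArg (g y).mulVec hu) a
  rw [Matrix.mulVec_mulVec, Matrix.mul_nonsing_inv _ (hg.isUnit_det y), Matrix.one_mulVec] at this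
  exact this

theorem raise (hg : IsMetricAt g x) (y : Fin 4 → ℝ) {u v : Fin 4 → ℝ}
    (h : ∀ a, v a = ∑ e, g y a e * u e) (a : Fin 4) : ∑ e, (g y)⁻¹ a e * v e = u a := by
  have hv : v = (g y).mulVec u := funext h
  have := congrFun (congrArg (g y)⁻¹.mulVec hv) a
  rw [Matrix.mulVec_mulVec, Matrix.nonsing_inv_mul _ (hg.isUnit_det y), Matrix.one_mulVec] at this
  exact this

theorem fun_symm (hg : IsMetricAt g x) (a b : Fin 4) :
    (fun y => g y a b) = fun y => g y b a := funext fun y => hg.symm y a b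

theorem christoffelLow_symm (hg : IsMetricAt g x) (a b c : Fin 4) (y : Fin 4 → ℝ) :
    christoffelLow g a b c y = christoffelLow g a c b y := by
  rw [christoffelLow, christoffelLow, hg.fun_symm a c, hg.fun_symm b a, hg.fun_symm b c]
  ring

theorem christoffel_symm (hg : IsMetricAt g x) (a b c : Fin 4) (y : Fin 4 → ℝ) :
    christoffel g a b c y = christoffel g a c b y := by
  simp only [christoffel_eq_sum, hg.christoffelLow_symm _ b c]

/-- Metric compatibility of the Levi-Civita connection. -/
theorem pderiv_eq (hg : IsMetricAt g x) (a b c : Fin 4) (y : Fin 4 → ℝ) :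
    pderiv c (fun y => g y a b) y = christoffelLow g a c b y + christoffelLow g b c a y := by
  rw [christoffelLow, christoffelLow, hg.fun_symm b a, hg.fun_symm c a, hg.fun_symm c b]
  ring

theorem sum_mul_christoffel (hg : IsMetricAt g x) (a b c : Fin 4) (y : Fin 4 → ℝ) :
    ∑ e, g y a e * christoffel g e b c y = christoffelLow g a b c y :=
  hg.lower y (fun e => christoffel_eq_sum g e b c y) a

theorem differentiableAt_christoffelLow (hg : IsMetricAt g x) (a b c : Fin 4) :
    DifferentiableAt ℝ (christoffelLow g a b c) x :=
  (((differentiableAt_pderiv (hg.contDiffAt _ _) _).add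
    (differentiableAt_pderiv (hg.contDiffAt _ _) _)).sub
    (differentiableAt_pderiv (hg.contDiffAt _ _) _)).const_mul _

theorem differentiableAt_christoffel (hg : IsMetricAt g x) (a b c : Fin 4) :
    DifferentiableAt ℝ (christoffel g a b c) x := by
  rw [funext (christoffel_eq_sum g a b c)]
  exact DifferentiableAt.fun_sum fun d _ =>
    (hg.differentiableAt_inv a d).mul (hg.differentiableAt_christoffelLow d b c)

theorem pderiv_christoffelLow (hg : IsMetricAt g x) (a b c i : Fin 4) :
    pderiv i (christoffelLow g a b c) x = (1 / 2) * (pderiv i (pderiv b fun y => g y a c) x +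
      pderiv i (pderiv c fun y => g y b a) x - pderiv i (pderiv a fun y => g y b c) x) := by
  have h1 := differentiableAt_pderiv (hg.contDiffAt a c) b
  have h2 := differentiableAt_pderiv (hg.contDiffAt b a) c
  have h3 := differentiableAt_pderiv (hg.contDiffAt b c) a
  have h := (((h1.hasFDerivAt.add h2.hasFDerivAt).sub h3.hasFDerivAt).const_mul (1 / 2)).fderiv
  exact congrArg (fun L => L (Pi.single i 1)) h

/-- Leibniz rule applied to `sum_mul_christoffel`, with the derivative of the metric replaced
through `pderiv_eq`. -/
theorem sum_mul_pderiv_christoffel (hg : IsMetricAt g x) (a b c i : Fin 4) :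
    ∑ e, g x a e * pderiv i (christoffel g e b c) x = pderiv i (christoffelLow g a b c) x -
      ∑ e, (christoffelLow g a i e x + christoffelLow g e i a x) * christoffel g e b c x := by
  have hgd : ∀ e, DifferentiableAt ℝ (fun y => g y a e) x := fun e =>
    (hg.contDiffAt a e).differentiableAt (by norm_num)
  rw [← funext (hg.sum_mul_christoffel a b c), pderiv_sum (f := fun e y => g y a e *
    christoffel g e b c y) fun e _ => (hgd e).mul (hg.differentiableAt_christoffel e b c)]
  simp only [pderiv_mul (hgd _) (hg.differentiableAt_christoffel _ b c), hg.pderiv_eq,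
    Finset.sum_add_distrib]
  ring

/-- The quadratic part of the Riemann tensor is symmetric under exchange of index pairs. -/
theorem sum_christoffelLow_mul_comm (hg : IsMetricAt g x) (a b c d : Fin 4) :
    ∑ e, christoffelLow g e a b x * christoffel g e c d x =
      ∑ e, christoffelLow g e c d x * christoffel g e a b x := by
  simp only [christoffel_eq_sum, Finset.mul_sum]
  rw [Finset.sum_comm]
  refine Finset.sum_congr rfl fun e _ => Finset.sum_congr rfl fun f _ => ?_
  rw [hg.inv_symm x f e]
  ring

/-- Here no derivative falls on the inverse metric, so the symmetries can be read off from second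
derivatives of `g` and a quadratic term. -/
theorem riemann_eq (hg : IsMetricAt g x) (a b c d : Fin 4) :
    riemann g x a b c d =
      pderiv c (christoffelLow g a d b) x - pderiv d (christoffelLow g a c b) x
      - ∑ e, christoffelLow g e c a x * christoffel g e d b x
      + ∑ e, christoffelLow g e d a x * christoffel g e c b x := by
  have h1 := hg.sum_mul_pderiv_christoffel a d b c
  have h2 := hg.sum_mul_pderiv_christoffel a c b d
  have h3 : ∑ e, g x a e * ∑ f, (christoffel g e c f x * christoffel g f d b x
          - christoffel g e d f x * christoffel g f c b x) =
      ∑ f, (christoffelLow g a c f x * christoffel g f d b x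
          - christoffelLow g a d f x * christoffel g f c b x) := by
    simp only [← hg.sum_mul_christoffel a, Finset.mul_sum, Finset.sum_mul, ← Finset.sum_sub_distrib]
    rw [Finset.sum_comm]
    refine Finset.sum_congr rfl fun e _ => Finset.sum_congr rfl fun f _ => ?_
    ring
  simp only [add_mul, Finset.sum_add_distrib] at h1 h2
  rw [Finset.sum_sub_distrib] at h3
  simp only [riemann, riemannUp, mul_add, mul_sub (g x a _) (pderiv _ _ _),
    Finset.sum_add_distrib]
  rw [h3, Finset.sum_sub_distrib, h1, h2]
  ring

theorem riemann_antisymm_right (hg : IsMetricAt g x) (a b c d : Fin 4) :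
    riemann g x a b c d = -riemann g x a b d c := by
  rw [hg.riemann_eq, hg.riemann_eq]
  ring

theorem riemann_pair (hg : IsMetricAt g x) (a b c d : Fin 4) :
    riemann g x a b c d = riemann g x c d a b := by
  rw [hg.riemann_eq, hg.riemann_eq]
  simp only [hg.pderiv_christoffelLow]
  have h1 : ∑ e, christoffelLow g e a c x * christoffel g e b d x =
      ∑ e, christoffelLow g e c a x * christoffel g e d b x := by
    simp only [hg.christoffelLow_symm _ a c, hg.christoffel_symm _ b d]
  have h2 : ∑ e, christoffelLow g e b c x * christoffel g e a d x =
      ∑ e, christoffelLow g e d a x * christoffel g e c b x := by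
    rw [hg.sum_christoffelLow_mul_comm]
    simp only [hg.christoffelLow_symm _ a d, hg.christoffel_symm _ b c]
  rw [h1, h2, pderiv_comm (hg.contDiffAt a b) d c, pderiv_comm (hg.contDiffAt c d) b a,
    hg.fun_symm d b, hg.fun_symm d a, hg.fun_symm c a, hg.fun_symm c b,
    pderiv_comm (hg.contDiffAt b d) c a, pderiv_comm (hg.contDiffAt b c) d a,
    pderiv_comm (hg.contDiffAt a c) d b, pderiv_comm (hg.contDiffAt a d) c b]
  ring

theorem riemann_bianchi (hg : IsMetricAt g x) (a b c d : Fin 4) :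
    riemann g x a b c d + riemann g x a c d b + riemann g x a d b c = 0 := by
  simp only [hg.riemann_eq]
  rw [funext (hg.christoffelLow_symm a d b), funext (hg.christoffelLow_symm a c b),
    funext (hg.christoffelLow_symm a d c)]
  simp only [hg.christoffel_symm _ d b, hg.christoffel_symm _ c b, hg.christoffel_symm _ d c]
  ring

theorem riemann_antisymm_left (hg : IsMetricAt g x) (a b c d : Fin 4) :
    riemann g x a b c d = -riemann g x b a c d := by
  rw [hg.riemann_pair, hg.riemann_antisymm_right, hg.riemann_pair c d]

theorem sum_inv_mul_riemann (hg : IsMetricAt g x) (b d : Fin 4) :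
    ∑ a, ∑ c, (g x)⁻¹ a c * riemann g x a b c d = ricci g x b d := by
  rw [Finset.sum_comm, ricci]
  refine Finset.sum_congr rfl fun c _ => ?_
  rw [← hg.raise x (u := fun e => riemannUp g x e b c d) (v := fun e => riemann g x e b c d)
    (fun e => rfl)]
  exact Finset.sum_congr rfl fun a _ => by rw [hg.inv_symm x a c]

theorem scalarCurv_eq (hg : IsMetricAt g x) {lam : ℝ}
    (hE : ∀ a b, ricci g x a b = lam * g x a b) : scalarCurv g x = 4 * lam := by
  have h : ∀ a, ∑ b, (g x)⁻¹ a b * ricci g x a b = lam := by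
    intro a
    have h1 := hg.sum_mul_inv x a a
    rw [if_pos rfl] at h1
    rw [← mul_one lam, ← h1, Finset.mul_sum]
    refine Finset.sum_congr rfl fun b _ => ?_
    rw [hE, hg.inv_symm x a b]
    ring
  simp [scalarCurv, h]

theorem riemann_eq_einsteinRiemann (hg : IsMetricAt g x) {lam : ℝ}
    (hE : ∀ a b, ricci g x a b = lam * g x a b) :
    riemann g x = einsteinRiemann lam (g x) (weyl g x) := by
  funext a b c d
  simp only [einsteinRiemann, weyl, hg.scalarCurv_eq hE, hE]
  ring

theorem isWeyl_weyl (hg : IsMetricAt g x) {lam : ℝ}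
    (hE : ∀ a b, ricci g x a b = lam * g x a b) : IsWeyl (g x) (weyl g x) := by
  have h : ∀ a b c d, weyl g x a b c d =
      riemann g x a b c d - lam / 3 * (g x a c * g x b d - g x a d * g x b c) := by
    intro a b c d
    rw [hg.riemann_eq_einsteinRiemann hE, einsteinRiemann]
    ring
  refine ⟨fun a b c d => ?_, fun a b c d => ?_, fun a b c d => ?_, fun a b c d => ?_,
    fun b d => ?_⟩
  · rw [h, h, hg.riemann_antisymm_left]
    ring
  · rw [h, h, hg.riemann_antisymm_right]
    ring
  · rw [h, h, hg.riemann_pair, hg.symm x c a, hg.symm x d b, hg.symm x c b, hg.symm x d a]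
    ring
  · rw [h, h, h, hg.symm x c b, hg.symm x d b, hg.symm x d c]
    linear_combination hg.riemann_bianchi a b c d
  · have h1 : ∀ a, ∑ c, (g x)⁻¹ a c * g x a c = 1 := by
      intro a
      have h1 := hg.sum_mul_inv x a a
      rw [if_pos rfl] at h1
      rw [← h1]
      exact Finset.sum_congr rfl fun c _ => by rw [hg.inv_symm x a c, mul_comm]
    have h2 : ∀ a, ∑ c, (g x)⁻¹ a c * g x b c = if b = a then 1 else 0 := by
      intro a
      rw [← hg.sum_mul_inv x b a]
      exact Finset.sum_congr rfl fun c _ => by rw [hg.inv_symm x a c, mul_comm]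
    have h3 : ∑ a, ∑ c, (g x)⁻¹ a c * (g x a c * g x b d) = 4 * g x b d := by
      simp only [← mul_assoc, ← Finset.sum_mul, h1]
      simp
    have h4 : ∑ a, ∑ c, (g x)⁻¹ a c * (g x a d * g x b c) = g x b d := by
      have : ∀ a, ∑ c, (g x)⁻¹ a c * (g x a d * g x b c) =
          g x a d * if b = a then 1 else 0 := by
        intro a
        rw [← h2 a, Finset.mul_sum]
        exact Finset.sum_congr rfl fun c _ => by ring
      simp [this]
    have h5 := hg.sum_inv_mul_riemann b d
    rw [hE] at h5
    have h6 : ∀ a c, (g x)⁻¹ a c * weyl g x a b c d = (g x)⁻¹ a c * riemann g x a b c d -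
        lam / 3 * ((g x)⁻¹ a c * (g x a c * g x b d) - (g x)⁻¹ a c * (g x a d * g x b c)) := by
      intro a c
      rw [h]
      ring
    -- The trace is `lam * g - lam / 3 * (4 * g - g) = 0`.
    simp only [h6, Finset.sum_sub_distrib, ← Finset.mul_sum, h3, h4, h5]
    ring

end IsMetricAt

/-! ### Walker metrics -/

theorem walkerMetric_mul_inv (A B C : (Fin 4 → ℝ) → ℝ) (x : Fin 4 → ℝ) :
    walkerMetric A B C x * !![0, 1, 0, 0; 1, -2 * A x, 0, -C x; 0, 0, 0, 1; 0, -C x, 1, -2 * B x] =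
      1 := by
  ext i j
  fin_cases i <;> fin_cases j <;> simp [walkerMetric, Matrix.mul_apply, Fin.sum_univ_four]

theorem walkerMetric_inv (A B C : (Fin 4 → ℝ) → ℝ) (x : Fin 4 → ℝ) :
    (walkerMetric A B C x)⁻¹ =
      !![0, 1, 0, 0; 1, -2 * A x, 0, -C x; 0, 0, 0, 1; 0, -C x, 1, -2 * B x] :=
  Matrix.inv_eq_right_inv (walkerMetric_mul_inv A B C x)

theorem walkerMetric_isMetricAt {A B C : (Fin 4 → ℝ) → ℝ} {x : Fin 4 → ℝ}
    (hA : ContDiffAt ℝ 2 A x) (hB : ContDiffAt ℝ 2 B x) (hC : ContDiffAt ℝ 2 C x) :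
    IsMetricAt (walkerMetric A B C) x where
  symm y a b := by fin_cases a <;> fin_cases b <;> rfl
  isUnit_det y := (Matrix.isUnit_iff_isUnit_det _).1
    (IsUnit.of_mul_eq_one _ (walkerMetric_mul_inv A B C y))
  contDiffAt a b := by
    fin_cases a <;> fin_cases b <;> simp [walkerMetric] <;> fun_prop
  differentiableAt_inv a b := by
    have hA' := hA.differentiableAt (by norm_num)
    have hB' := hB.differentiableAt (by norm_num)
    have hC' := hC.differentiableAt (by norm_num)
    simp only [walkerMetric_inv]
    fin_cases a <;> fin_cases b <;> simp <;> fun_prop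

/-- Part of the parallelism of the null plane: covariant derivatives of `∂_v` and `∂_V` have no
`∂_u` component. -/
theorem walkerMetric_christoffel_zero (A B C : (Fin 4 → ℝ) → ℝ) (i j : Fin 4) (hj : j = 1 ∨ j = 3)
    (y : Fin 4 → ℝ) : christoffel (walkerMetric A B C) 0 i j y = 0 := by
  rw [christoffel_eq_sum, walkerMetric_inv]
  rcases hj with rfl | rfl <;> fin_cases i <;>
    simp [Fin.sum_univ_four, christoffelLow, walkerMetric, pderiv]

theorem walkerMetric_christoffel_two (A B C : (Fin 4 → ℝ) → ℝ) (i : Fin 4) (y : Fin 4 → ℝ) :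
    christoffel (walkerMetric A B C) 2 i 3 y = 0 := by
  rw [christoffel_eq_sum, walkerMetric_inv]
  fin_cases i <;> simp [Fin.sum_univ_four, christoffelLow, walkerMetric, pderiv]

/-- The curvature preserves the parallel null plane. -/
theorem walkerMetric_riemann_one_three (A B C : (Fin 4 → ℝ) → ℝ) (x : Fin 4 → ℝ) (c d : Fin 4) :
    riemann (walkerMetric A B C) x 1 3 c d = 0 := by
  have h : riemann (walkerMetric A B C) x 1 3 c d = riemannUp (walkerMetric A B C) x 0 3 c d := by
    simp [riemann, walkerMetric, Fin.sum_univ_four]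
  have h1 := fun i => walkerMetric_christoffel_zero A B C i 1 (Or.inl rfl)
  have h3 := fun i => walkerMetric_christoffel_zero A B C i 3 (Or.inr rfl)
  have hf : ∀ i, christoffel (walkerMetric A B C) 0 i 3 = fun _ => 0 := fun i => funext (h3 i)
  -- In `Γ^0_{ce} Γ^e_{d3}` the first factor vanishes for `e = 1, 3` and the second for `e = 0, 2`.
  rw [h, riemannUp, Fin.sum_univ_four]
  simp only [h1, walkerMetric_christoffel_two, hf]
  simp [pderiv]

/-! ### Null tetrads of a Walker metric -/

/-- The matrix whose columns are the vectors of a tetrad. -/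
def Tetrad.toMatrix (e : Tetrad) : Matrix (Fin 4) (Fin 4) ℝ :=
  Matrix.of fun i a => (![e.l, e.n, e.m, e.mt] : Fin 4 → Fin 4 → ℝ) a i

theorem transpose_mul_mul_apply (P g : Matrix (Fin 4) (Fin 4) ℝ) (a b : Fin 4) :
    (P.transpose * g * P) a b = ip g (P.col a) (P.col b) := by
  simp only [Matrix.mul_apply, Finset.sum_mul, Matrix.transpose_apply, ip, Matrix.col]
  rw [Finset.sum_comm]
  exact Finset.sum_congr rfl fun i _ => Finset.sum_congr rfl fun j _ => by ring

theorem ip_comm {g : Matrix (Fin 4) (Fin 4) ℝ} (hg : ∀ a b, g a b = g b a) (X Y : Fin 4 → ℝ) :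
    ip g X Y = ip g Y X := by
  rw [ip, ip, Finset.sum_comm]
  exact Finset.sum_congr rfl fun i _ => Finset.sum_congr rfl fun j _ => by rw [hg]; ring

theorem Tetrad.IsNull.toMatrix_eq {g : Matrix (Fin 4) (Fin 4) ℝ} (hg : ∀ a b, g a b = g b a)
    {e : Tetrad} (he : e.IsNull g) : e.toMatrix.transpose * g * e.toMatrix = eta := by
  have c0 : e.toMatrix.col 0 = e.l := rfl
  have c1 : e.toMatrix.col 1 = e.n := rfl
  have c2 : e.toMatrix.col 2 = e.m := rfl
  have c3 : e.toMatrix.col 3 = e.mt := rfl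
  ext a b
  rw [transpose_mul_mul_apply]
  fin_cases a <;> fin_cases b <;>
    simp [c0, c1, c2, c3, eta, he.l_n, he.m_mt, he.l_l, he.n_n, he.m_m, he.mt_mt, he.l_m, he.l_mt,
      he.n_m, he.n_mt, ip_comm hg e.n e.l, ip_comm hg e.mt e.m, ip_comm hg e.m e.l,
      ip_comm hg e.mt e.l, ip_comm hg e.m e.n, ip_comm hg e.mt e.n]

theorem apply_eq_zero_of_mem_span {X : Fin 4 → ℝ}
    (hX : X ∈ Submodule.span ℝ {(Pi.single 1 1 : Fin 4 → ℝ), Pi.single 3 1}) :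
    X 0 = 0 ∧ X 2 = 0 := by
  obtain ⟨s, t, rfl⟩ := Submodule.mem_span_pair.1 hX
  constructor <;> simp

/-- In an adapted tetrad of an Einstein Walker metric, `Ψ̃₀ = Ψ̃₁ = 0` and `Ψ̃₂ = -lam / 3`. -/
theorem walkerMetric_framePsi' {A B C : (Fin 4 → ℝ) → ℝ} {x : Fin 4 → ℝ}
    (hg : IsMetricAt (walkerMetric A B C) x) {lam : ℝ}
    (hE : ∀ a b, ricci (walkerMetric A B C) x a b = lam * walkerMetric A B C x a b) {e : Tetrad}
    (he : e.IsNull (walkerMetric A B C x)) (ha : e.IsAdapted) :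
    ∃ b y, framePsi' ((weyl (walkerMetric A B C) x).pull e.toMatrix) =
      ![0, 0, -(lam / 3), b, y] := by
  have hP := he.toMatrix_eq (hg.symm x)
  have hR := einsteinRiemann_pull (g := walkerMetric A B C x) (isUnit_det_of_frame hP) lam
    (weyl (walkerMetric A B C) x)
  rw [← hg.riemann_eq_einsteinRiemann hE, hP] at hR
  obtain ⟨l0, l2⟩ := apply_eq_zero_of_mem_span ha.1
  obtain ⟨m0, m2⟩ := apply_eq_zero_of_mem_span ha.2
  have hs : ∀ a c d, riemann (walkerMetric A B C) x a a c d = 0 := fun a c d => by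
    linarith [hg.riemann_antisymm_left a a c d]
  have h13 := walkerMetric_riemann_one_three A B C x
  have h31 : ∀ c d, riemann (walkerMetric A B C) x 3 1 c d = 0 := fun c d => by
    rw [hg.riemann_antisymm_left, h13, neg_zero]
  have key : ∀ a b c d, riemann (walkerMetric A B C) x a b c d * e.l a * e.mt b = 0 := by
    intro a b c d
    fin_cases a <;> fin_cases b <;> simp [l0, l2, m0, m2, hs, h13, h31]
  -- The Riemann tensor vanishes on the pair `ℓ, m̃`, which spans the parallel plane, so there the
  -- Weyl tensor is minus the constant-curvature term.
  have h03 : ∀ c d, (weyl (walkerMetric A B C) x).pull e.toMatrix 0 3 c d =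
      -(lam / 3 * (eta 0 c * eta 3 d - eta 0 d * eta 3 c)) := by
    intro c d
    have h := congrFun (congrFun (congrFun (congrFun hR 0) 3) c) d
    have h0 : (riemann (walkerMetric A B C) x).pull e.toMatrix 0 3 c d = 0 := by
      change Tensor4.contr _ e.l e.mt _ _ = 0
      simp only [Tensor4.contr, key, zero_mul, Finset.sum_const_zero]
    rw [h0, einsteinRiemann] at h
    linarith
  refine ⟨(weyl (walkerMetric A B C) x).pull e.toMatrix 0 1 2 1,
    (weyl (walkerMetric A B C) x).pull e.toMatrix 1 2 1 2, ?_⟩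
  rw [framePsi', h03, h03, h03]
  simp [eta]

theorem TensorExpr.eval_symmetrization (T : TensorExpr 2) (g : Matrix (Fin 4) (Fin 4) ℝ)
    (R W : Tensor4) (i j : Fin 4) :
    (TensorExpr.smul (1 / 2) (.add T (.perm (Equiv.swap 0 1) T))).eval g R W ![i, j] =
      1 / 2 * (T.eval g R W ![i, j] + T.eval g R W ![j, i]) := by
  have h : (fun k => (![i, j] : Fin 2 → Fin 4) (Equiv.swap 0 1 k)) = ![j, i] := by
    ext k
    fin_cases k <;> rfl
  simp only [TensorExpr.eval, h]

end
end WalkerGeom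

/-! The alternative on `Ψ̃₃` or `Ψ₁, Ψ₃` is not needed: a Weyl tensor with `Ψ̃₂ ≠ 0` has a null tetrad
with `Ψ̃₃ = 0`, and the case `Ψ̃₂ = 0` is a limit of this one. -/

theorem mainTheorem2 (Ω : Set (Fin 4 → ℝ)) (hΩ : IsOpen Ω)
    (A B C : (Fin 4 → ℝ) → ℝ)
    (hA : ContDiffOn ℝ 2 A Ω) (hB : ContDiffOn ℝ 2 B Ω) (hC : ContDiffOn ℝ 2 C Ω)
    (hE : WalkerGeom.IsEinsteinOn (WalkerGeom.walkerMetric A B C) Ω)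
    (e : (Fin 4 → ℝ) → WalkerGeom.Tetrad)
    (he : ∀ x ∈ Ω, (e x).IsNull (WalkerGeom.walkerMetric A B C x) ∧ (e x).IsAdapted)
    (ψ : Fin 5 → ℝ)
    (hψ : ∀ x ∈ Ω, (e x).psi (WalkerGeom.weyl (WalkerGeom.walkerMetric A B C) x) = ψ)
    (h : (∀ x ∈ Ω, (e x).psiTilde (WalkerGeom.weyl (WalkerGeom.walkerMetric A B C) x) 3 = 0) ∨
      ψ 1 ^ 2 * ψ 4 = ψ 0 * ψ 3 ^ 2) :
    WalkerGeom.IsZeroUniversalOn (WalkerGeom.walkerMetric A B C) Ω := by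
  open WalkerGeom in
  obtain ⟨lam, hlam⟩ := hE
  intro T hT
  -- `T` is symmetric only for the given metric on `Ω`, whereas the boost argument varies `Ψ̃`
  -- freely. The symmetrization is symmetric for all values and agrees with `T` on `Ω`.
  let S : TensorExpr 2 := .smul (1 / 2) (.add T (.perm (Equiv.swap 0 1) T))
  have hS : ∀ ψ' i j, S.frameEval lam ψ ψ' i j = S.frameEval lam ψ ψ' j i := by
    intro ψ' i j
    simp only [S, TensorExpr.frameEval, TensorExpr.eval_symmetrization, add_comm]
  refine ⟨S.frameEval lam ψ ![0, 0, -(lam / 3), 0, 0] 0 1, fun x hx a b => ?_⟩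
  have hg : IsMetricAt (walkerMetric A B C) x := walkerMetric_isMetricAt
    (hA.contDiffAt (hΩ.mem_nhds hx)) (hB.contDiffAt (hΩ.mem_nhds hx))
    (hC.contDiffAt (hΩ.mem_nhds hx))
  have hP := (he x hx).1.toMatrix_eq (hg.symm x)
  obtain ⟨p, q, hpq⟩ := walkerMetric_framePsi' hg (hlam x hx) (he x hx).1 (he x hx).2
  have hpsi : framePsi ((weyl (walkerMetric A B C) x).pull (e x).toMatrix) = ψ := hψ x hx
  have key := S.frameEval_eq hP (hg.isWeyl_weyl (hlam x hx)) lam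
  rw [hpq, hpsi, S.frameEval_eq_smul_eta lam ψ hS, ← hg.riemann_eq_einsteinRiemann (hlam x hx)]
    at key
  -- Writing `eta` as the conjugate of the metric turns `key` into an equality of two conjugates,
  -- from which the tetrad cancels.
  conv_lhs at key => rw [← hP, ← Matrix.smul_mul, ← Matrix.mul_smul]
  have hab := congrFun (congrFun (conjugate_cancel (isUnit_det_of_frame hP) key) a) b
  rw [Matrix.of_apply, TensorExpr.eval_symmetrization] at hab
  have hsym := hT x hx a b
  simp only [TensorExpr.field2] at hsym ⊢
  rw [← hsym] at hab
  have hc : (S.frameEval lam ψ ![0, 0, -(lam / 3), 0, 0] 0 1 • walkerMetric A B C x) a b =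
    S.frameEval lam ψ ![0, 0, -(lam / 3), 0, 0] 0 1 * walkerMetric A B C x a b := rfl
  linarith
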